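/- Let $d\ge 0$ and let $Q\subset\mathbb R^d$ be compact. Let $X$ be a random element of $L^2(Q)$ (Lebesgue measure) with $\mathbb E\|X\|^2<\infty$, mean $m=\mathbb E X$ and covariance operator $\mathcal C=\mathbb E\{(X-m)\otimes(X-m)\}$, where $(h\otimes g)f=\langle f,g\rangle h$. Let $c:Q\times Q\to\mathbb R$ be a kernel of $\mathcal C$, i.e. $c\in L^2(Q\times Q)$ and, for every $f\in L^2(Q)$, $\mathcal Cf(u)=\int_Q c(u,v)f(v)\,dv$ for almost every $u\in Q$. Let $\sigma:\mathbb R\to[0,1]$ be sigmoidal, i.e. non-decreasing with $\lim_{t\to\infty}\sigma(t)=1$ and $\lim_{t\to-\infty}\sigma(t)=0$. For an integer $R\ge1$ let $\mathcal F_{R,\sigma}$ be the set of shallow CovNet kernels $$g(u,v)=\sum_{r=1}^R\sum_{s=1}^R\lambda_{r,s}\,\sigma(w_r^\top u+b_r)\,\sigma(w_s^\top v+b_s)$$ with $w_1,\dots,w_R\in\mathbb R^d$, $b_1,\dots,b_R\in\mathbb R$ and $\Lambda=(\lambda_{r,s})$ symmetric positive semi-definite. Then for every $\epsilon>0$ there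 are $R\ge1$ and $g\in\mathcal F_{R,\sigma}$ such that $$\int_{Q\times Q}|c(u,v)-g(u,v)|^2\,du\,dv\le\epsilon .$$ Suppose in addition that $c$ is continuous on $Q\times Q$, and that either every non-empty relatively open subset of $Q$ has positive Lebesgue measure, or $c$ is non-negative definite on $Q$ (every matrix $(c(x_i,x_j))_{i,j}$ with $x_1,\dots,x_n\in Q$ is symmetric positive semi-definite; this is automatic if $c(u,v)=\operatorname{cov}(X(u),X(v))$ for all $u,v\in Q$ for a second-order random field $(X(u))_{u\in Q}$). Then for every $\epsilon>0$ there are $R\ge1$ and $g\in\mathcal F_{R,\sigma}$ such that $$\sup_{u,v\in Q}|c(u,v)-g(u,v)|\le\epsilon .$$ -/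

import Mathlib

open MeasureTheory Filter Topology

/-- A sigmoidal activation: a non-decreasing function with values in `[0, 1]`, tending to `1`
at `+∞` and to `0` at `-∞`. -/
structure IsSigmoidal (σ : ℝ → ℝ) : Prop where
  mem_Icc : ∀ t, σ t ∈ Set.Icc (0 : ℝ) 1
  monotone : Monotone σ
  tendsto_atTop : Tendsto σ atTop (𝓝 1)
  tendsto_atBot : Tendsto σ atBot (𝓝 0)

/-- The class of shallow CovNet kernels of width `R` on `ℝᵈ` with activation `σ`. -/
def shallowCovNet (d : ℕ) (σ : ℝ → ℝ) (R : ℕ) :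
    Set (EuclideanSpace ℝ (Fin d) → EuclideanSpace ℝ (Fin d) → ℝ) :=
  {g | ∃ (Λ : Matrix (Fin R) (Fin R) ℝ) (w : Fin R → EuclideanSpace ℝ (Fin d)) (b : Fin R → ℝ),
    Λ.PosSemidef ∧ ∀ u v, g u v =
      ∑ r, ∑ s, Λ r s * σ (inner ℝ (w r) u + b r) * σ (inner ℝ (w s) v + b s)}

/-- The Hilbert space of (classes of) real square-integrable functions on `Q ⊆ ℝᵈ`, with
Lebesgue measure. -/
abbrev L2On {d : ℕ} (Q : Set (EuclideanSpace ℝ (Fin d))) : Type :=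
  Lp ℝ 2 ((volume : Measure (EuclideanSpace ℝ (Fin d))).restrict Q)

/-- The covariance operator `E[(X - m) ⊗ (X - m)]`, `m = E[X]`, of a random element `X` of a
Hilbert space; both expectations are Bochner integrals, and `h ⊗ g` is `f ↦ ⟪f, g⟫ h`. -/
noncomputable def covOperator {H : Type*} [NormedAddCommGroup H] [InnerProductSpace ℝ H]
    {Ω : Type*} [MeasurableSpace Ω] (P : Measure Ω) (X : Ω → H) : H →L[ℝ] H :=
  ∫ ω, InnerProductSpace.rankOne ℝ (X ω - ∫ ω', X ω' ∂P) (X ω - ∫ ω', X ω' ∂P) ∂P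

/-- `c ∈ L²(Q × Q)` is the kernel of the operator `A` on `L²(Q)`:
`(A f)(u) = ∫_Q c(u, v) f(v) dv` for almost every `u ∈ Q`. -/
def IsKernelOf {d : ℕ} (Q : Set (EuclideanSpace ℝ (Fin d)))
    (c : EuclideanSpace ℝ (Fin d) → EuclideanSpace ℝ (Fin d) → ℝ)
    (A : L2On Q →L[ℝ] L2On Q) : Prop :=
  MemLp (Function.uncurry c) 2 (volume.restrict (Q ×ˢ Q)) ∧
    ∀ f : L2On Q, ∀ᵐ u ∂(volume.restrict Q), A f u = ∫ v in Q, c u v * f v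

/-- `c` is a (symmetric) non-negative definite kernel on `Q`: all the matrices
`(c(xᵢ, xⱼ))ᵢⱼ` with `x₁, …, xₙ ∈ Q` are positive semi-definite. -/
def IsNonnegDefiniteOn {E : Type*} (Q : Set E) (c : E → E → ℝ) : Prop :=
  ∀ (n : ℕ) (x : Fin n → E), (∀ i, x i ∈ Q) →
    (Matrix.of fun i j => c (x i) (x j)).PosSemidef

/-- Lebesgue measure charges every non-empty relatively open subset of `Q`. -/
def HasFullLebesgueSupport {d : ℕ} (Q : Set (EuclideanSpace ℝ (Fin d))) : Prop :=
  ∀ U : Set (EuclideanSpace ℝ (Fin d)), IsOpen U → (Q ∩ U).Nonempty → 0 < volume (Q ∩ U)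

/-! The difficulty is that the coefficient matrix must be positive semi-definite. If `A` is positive
semi-definite and each `ψ i` is a shallow network, then `∑ A i j ψ i(u) ψ j(v)` is a CovNet kernel:
over a common pool of neurons its matrix is the congruence `aᵀ A a` (`exists_mem_shallowCovNet`). It
is thus enough to approximate `c` by such sums with arbitrary networks. Networks are uniformly dense
in `C(Q)` (`uniformLimits_shallowNet`).

Uniform approximation: a fine partition of unity `φ i` centred at points `x i` of `Q` gives `c ≈ ∑
c(x i, x j) φ i ⊗ φ j`, and networks replace the `φ i`. The coefficients are samples of `c`, hence
positive semi-definite once `c` is non-negative definite. Under full support this property is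
inherited from the covariance operator, as values of `c` are limits of its matrix elements.

Mean square: point values of `c` mean nothing, and a good approximant by networks may have an
indefinite matrix. Its networks are therefore orthonormalized in `L²(Q)` to `e k`, and its
coefficients are replaced by the Fourier coefficients of `c` along `e k ⊗ e l`. Orthogonal
projection does not increase the error, and these coefficients are the matrix elements `⟪e k, 𝒞 e
l⟫` of a positive operator. -/

/-! ### Shallow networks and the kernels they generate -/

/-- The space of shallow neural networks with activation `σ` on `ℝᵈ`. -/
def shallowNet (d : ℕ) (σ : ℝ → ℝ) : Submodule ℝ (EuclideanSpace ℝ (Fin d) → ℝ) :=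
  Submodule.span ℝ (Set.range fun p : EuclideanSpace ℝ (Fin d) × ℝ =>
    fun u => σ (inner ℝ p.1 u + p.2))

theorem neuron_mem_shallowNet {d : ℕ} (σ : ℝ → ℝ) (w : EuclideanSpace ℝ (Fin d)) (b : ℝ) :
    (fun u => σ (inner ℝ w u + b)) ∈ shallowNet d σ :=
  Submodule.subset_span ⟨(w, b), rfl⟩

/-- Finitely many shallow networks can be written over a common non-empty pool of neurons. -/
theorem exists_common_neurons {d n : ℕ} {σ : ℝ → ℝ} (ψ : Fin n → EuclideanSpace ℝ (Fin d) → ℝ)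
    (hψ : ∀ i, ψ i ∈ shallowNet d σ) :
    ∃ R : ℕ, 1 ≤ R ∧ ∃ (w : Fin R → EuclideanSpace ℝ (Fin d)) (b : Fin R → ℝ)
      (a : Matrix (Fin n) (Fin R) ℝ),
      ∀ i u, ψ i u = ∑ r, a i r * σ (inner ℝ (w r) u + b r) := by
  classical
  have h := fun i => (Finsupp.mem_span_range_iff_exists_finsupp).1 (hψ i)
  choose l hl using h
  -- Inserting `0` keeps the pool non-empty, so that `1 ≤ R` even when no neuron is used.
  let s : Finset (EuclideanSpace ℝ (Fin d) × ℝ) := insert 0 (Finset.univ.biUnion fun i => (l i).support)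
  let e := s.equivFin
  refine ⟨s.card, Finset.card_pos.2 (Finset.insert_nonempty _ _), fun r => (e.symm r).1.1,
    fun r => (e.symm r).1.2, fun i r => l i (e.symm r).1, fun i u => ?_⟩
  have hsub : (l i).support ⊆ s := fun x hx =>
    Finset.mem_insert_of_mem (Finset.mem_biUnion.2 ⟨i, Finset.mem_univ _, hx⟩)
  rw [← hl i, Finsupp.sum_of_support_subset _ hsub _ (by simp), Finset.sum_apply,
    ← Finset.sum_coe_sort s, ← e.symm.sum_comp]
  rfl

theorem exists_mem_shallowCovNet {d n : ℕ} {σ : ℝ → ℝ} {A : Matrix (Fin n) (Fin n) ℝ}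
    (hA : A.PosSemidef) (ψ : Fin n → EuclideanSpace ℝ (Fin d) → ℝ)
    (hψ : ∀ i, ψ i ∈ shallowNet d σ) :
    ∃ R : ℕ, 1 ≤ R ∧
      (fun u v => ∑ i, ∑ j, A i j * ψ i u * ψ j v) ∈ shallowCovNet d σ R := by
  obtain ⟨R, hR, w, b, a, h⟩ := exists_common_neurons ψ hψ
  refine ⟨R, hR, a.conjTranspose * A * a, w, b, hA.conjTranspose_mul_mul_same a, fun u v => ?_⟩
  simp only [h, Matrix.mul_apply, Matrix.conjTranspose_apply, star_trivial, Finset.sum_mul,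
    Finset.mul_sum]
  simp_rw [Finset.sum_comm (s := (Finset.univ : Finset (Fin n))) (t := (Finset.univ : Finset (Fin R)))]
  rw [Finset.sum_comm]
  refine Finset.sum_congr rfl fun r _ => Finset.sum_congr rfl fun s _ => ?_
  rw [Finset.sum_comm]
  refine Finset.sum_congr rfl fun i _ => Finset.sum_congr rfl fun j _ => ?_
  ring

/-! ### Sigmoidal approximation in one variable -/

/-- Tail estimate for a sigmoidal function. -/
theorem IsSigmoidal.exists_tail {σ : ℝ → ℝ} (hσ : IsSigmoidal σ) {η : ℝ} (hη : 0 < η) :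
    ∃ T : ℝ, 0 < T ∧ (∀ t, T ≤ t → |σ t - 1| ≤ η) ∧ ∀ t, t ≤ -T → |σ t| ≤ η := by
  obtain ⟨T₁, h₁⟩ := eventually_atTop.1 (Metric.tendsto_nhds.1 hσ.tendsto_atTop η hη)
  obtain ⟨T₂, h₂⟩ := eventually_atBot.1 (Metric.tendsto_nhds.1 hσ.tendsto_atBot η hη)
  refine ⟨max 1 (max T₁ (-T₂)), by positivity, fun t ht => ?_, fun t ht => ?_⟩
  · exact (h₁ t ((le_max_left _ _).trans ((le_max_right _ _).trans ht))).le
  · have : -T₂ ≤ max 1 (max T₁ (-T₂)) := (le_max_right _ _).trans (le_max_right _ _)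
    simpa using (h₂ t (by linarith)).le

/-- A continuous function on a compact interval is a uniform limit of superpositions of
dilated and translated copies of a sigmoidal function. -/
theorem IsSigmoidal.exists_approx_Icc {σ : ℝ → ℝ} (hσ : IsSigmoidal σ) {h : ℝ → ℝ}
    (hh : Continuous h) (a b : ℝ) {ε : ℝ} (hε : 0 < ε) :
    ∃ g ∈ Submodule.span ℝ (Set.range fun p : ℝ × ℝ => fun t : ℝ => σ (p.1 * t + p.2)),
      ∀ t ∈ Set.Icc a b, |h t - g t| ≤ ε := by
  -- The grid `a + i δ` may overshoot `b` by up to `δ ≤ 1`, hence `b + 1`. The budget in fifths of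
  -- `ε`: one for the constant `h a`, three for the jumps, one for the oscillation of `h` within a
  -- cell.
  have huc := isCompact_Icc (a := a) (b := b + 1) |>.uniformContinuousOn_of_continuous
    hh.continuousOn
  obtain ⟨δ', hδ', hδh'⟩ := Metric.uniformContinuousOn_iff.1 huc (ε / 5) (by positivity)
  set δ := min 1 (δ' / 2) with hδdef
  have hδ : 0 < δ := by positivity
  have hδ1 : δ ≤ 1 := min_le_left _ _
  have hδh : ∀ x ∈ Set.Icc a (b + 1), ∀ y ∈ Set.Icc a (b + 1), |x - y| ≤ δ →
      |h x - h y| ≤ ε / 5 := fun x hx y hy hxy =>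
    (hδh' x hx y hy (by
      rw [Real.dist_eq]; exact hxy.trans_lt ((min_le_right _ _).trans_lt (by linarith)))).le
  set n := ⌈(b - a) / δ⌉₊ with hn
  set τ : ℕ → ℝ := fun i => a + i * δ with hτ
  obtain ⟨T, hT, hT1, hT0⟩ := hσ.exists_tail (η := 1 / (n + 1)) (by positivity)
  obtain ⟨B, -, hB, -⟩ := hσ.exists_tail (η := ε / 5 / (|h a| + 1)) (by positivity)
  -- A smoothed staircase through the grid values of `h`. The constant comes from a neuron with zero
  -- weight and large bias; the slope `T / δ` completes each step, up to the tail error, within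
  -- distance `δ` of `τ i`.
  refine ⟨h a • (fun t => σ (0 * t + B)) + ∑ i ∈ Finset.range n,
    (h (τ (i + 1)) - h (τ i)) • fun t => σ (T / δ * t + -(T / δ * τ i)), ?_, ?_⟩
  · refine Submodule.add_mem _ (Submodule.smul_mem _ _ (Submodule.subset_span ⟨(0, B), rfl⟩))
      (Submodule.sum_mem _ fun i _ => Submodule.smul_mem _ _ (Submodule.subset_span ⟨(_, _), rfl⟩))
  intro t ht
  have hτmem : ∀ i ≤ n, τ i ∈ Set.Icc a (b + 1) := by
    intro i hi
    have h1 : (n : ℝ) < (b - a) / δ + 1 :=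
      Nat.ceil_lt_add_one (div_nonneg (by linarith [ht.1, ht.2]) hδ.le)
    have h2 : (i : ℝ) * δ ≤ n * δ := by gcongr
    have h3 : (n : ℝ) * δ < ((b - a) / δ + 1) * δ := by gcongr
    rw [add_mul, div_mul_cancel₀ _ hδ.ne'] at h3
    exact ⟨by simp only [hτ]; nlinarith [Nat.cast_nonneg (α := ℝ) i], by simp only [hτ]; linarith⟩
  have hstep : ∀ i ∈ Finset.range n, |h (τ (i + 1)) - h (τ i)| ≤ ε / 5 := by
    intro i hi
    have hi := Finset.mem_range.1 hi
    refine hδh _ (hτmem _ hi) _ (hτmem _ hi.le) ?_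
    simp only [hτ]; push_cast
    rw [show a + (i + 1) * δ - (a + i * δ) = δ by ring, abs_of_pos hδ]
  obtain ⟨j, hj1, hj2, hjn⟩ : ∃ j : ℕ, τ j ≤ t ∧ t < τ (j + 1) ∧ j ≤ n := by
    have h0 : 0 ≤ (t - a) / δ := div_nonneg (by linarith [ht.1]) hδ.le
    refine ⟨⌊(t - a) / δ⌋₊, ?_, ?_, ?_⟩
    · have := (le_div_iff₀ hδ).1 (Nat.floor_le h0)
      simp only [hτ]; linarith
    · have := (div_lt_iff₀ hδ).1 (Nat.lt_floor_add_one ((t - a) / δ))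
      simp only [hτ]; push_cast; linarith
    · refine (Nat.floor_le_ceil _).trans (Nat.ceil_mono ?_)
      gcongr; exact ht.2
  -- Comparison with the sharp step: at distance at least `δ` from `τ i` the tail bound applies;
  -- only `i = j` and `i = j + 1` can be closer, with error at most `1`.
  have hterm : ∀ i : ℕ, |σ (T / δ * t + -(T / δ * τ i)) - (if i < j then 1 else 0)| ≤
      1 / (n + 1) + ((if j = i then 1 else 0) + (if j + 1 = i then 1 else 0)) := by
    intro i
    have hpos : (0 : ℝ) ≤ 1 / (n + 1) := by positivity
    rw [show T / δ * t + -(T / δ * τ i) = T * ((t - τ i) / δ) by ring]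
    have hI := hσ.mem_Icc (T * ((t - τ i) / δ))
    rcases lt_trichotomy i j with hij | hij | hij
    · have hc : (i : ℝ) + 1 ≤ j := by exact_mod_cast hij
      have : 1 ≤ (t - τ i) / δ := by
        rw [le_div_iff₀ hδ]; simp only [hτ] at hj1 ⊢; nlinarith
      rw [if_pos hij, if_neg (by omega), if_neg (by omega)]
      simpa using hT1 _ (le_mul_of_one_le_right hT.le this)
    · rw [if_neg (by omega), if_pos hij.symm, if_neg (by omega), sub_zero, abs_of_nonneg hI.1]
      linarith [hI.2]
    · rcases eq_or_ne (j + 1) i with h1 | h1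
      · rw [if_neg (by omega), if_neg (by omega), if_pos h1, sub_zero, abs_of_nonneg hI.1]
        linarith [hI.2]
      · have hc : (j : ℝ) + 1 + 1 ≤ i := by exact_mod_cast (by omega : j + 1 + 1 ≤ i)
        have : (t - τ i) / δ ≤ -1 := by
          rw [div_le_iff₀ hδ]; simp only [hτ] at hj2 ⊢; push_cast at hj2; nlinarith
        rw [if_neg (by omega), if_neg (by omega), if_neg h1, sub_zero]
        simpa using hT0 (T * ((t - τ i) / δ)) (by nlinarith)
  have htel : ∑ i ∈ Finset.range n, (h (τ (i + 1)) - h (τ i)) * (if i < j then 1 else 0)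
      = h (τ j) - h a := by
    have : h a = h (τ 0) := by simp [hτ]
    rw [this, ← Finset.sum_range_sub (fun i => h (τ i)) j]
    simp only [mul_ite, mul_one, mul_zero]
    rw [← Finset.sum_filter]
    congr 1
    ext i; simp; omega
  -- The factor `3`: at most `n` tail errors of `1 / (n + 1)` sum to at most `1`, and the two
  -- exceptional indices add `1` each.
  have hsum : |∑ i ∈ Finset.range n, (h (τ (i + 1)) - h (τ i)) *
      (σ (T / δ * t + -(T / δ * τ i)) - (if i < j then 1 else 0))| ≤ 3 * (ε / 5) := by
    calc _ ≤ ∑ i ∈ Finset.range n, ε / 5 *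
          (1 / (n + 1) + ((if j = i then 1 else 0) + (if j + 1 = i then 1 else 0))) := by
          refine (Finset.abs_sum_le_sum_abs _ _).trans (Finset.sum_le_sum fun i hi => ?_)
          rw [abs_mul]
          exact mul_le_mul (hstep i hi) (hterm i) (abs_nonneg _) (by positivity)
      _ ≤ ε / 5 * (1 + (1 + 1)) := by
          rw [← Finset.mul_sum, Finset.sum_add_distrib, Finset.sum_add_distrib,
            Finset.sum_ite_eq, Finset.sum_ite_eq, Finset.sum_const, Finset.card_range, nsmul_eq_mul]
          gcongr
          · rw [mul_one_div, div_le_one (by positivity)]; linarith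
          · split_ifs <;> norm_num
          · split_ifs <;> norm_num
      _ = _ := by ring
  have hconst : |h a * (σ (0 * t + B) - 1)| ≤ ε / 5 := by
    have h1 := hB (0 * t + B) (by simp)
    rw [abs_mul]
    calc _ ≤ (|h a| + 1) * (ε / 5 / (|h a| + 1)) := by gcongr; linarith
      _ = _ := by field_simp
  have hlast : |h t - h (τ j)| ≤ ε / 5 := by
    refine hδh _ ⟨ht.1, by linarith [ht.2]⟩ _ (hτmem _ hjn) ?_
    simp only [hτ] at hj1 hj2 ⊢; push_cast at hj2
    rw [abs_of_nonneg (by linarith)]; linarith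
  simp only [mul_sub, Finset.sum_sub_distrib, htel] at hsum
  simp only [Pi.add_apply, Pi.smul_apply, Finset.sum_apply, smul_eq_mul]
  rw [abs_le] at *
  constructor <;> linarith [hsum.1, hsum.2, hconst.1, hconst.2, hlast.1, hlast.2]

/-! ### Universal approximation on compact sets -/

/-- The continuous functions on `Q` that are uniform limits on `Q` of elements of a space `N` of
functions. -/
def uniformLimits {E : Type*} [TopologicalSpace E] (Q : Set E) (N : Submodule ℝ (E → ℝ)) :
    Submodule ℝ C(Q, ℝ) where
  carrier := {f | ∀ ε : ℝ, 0 < ε → ∃ ψ ∈ N, ∀ u : Q, |f u - ψ u| ≤ ε}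
  zero_mem' ε hε := ⟨0, N.zero_mem, fun u => by simpa using hε.le⟩
  add_mem' {f g} hf hg ε hε := by
    obtain ⟨φ, hφ, h1⟩ := hf (ε / 2) (by positivity)
    obtain ⟨ψ, hψ, h2⟩ := hg (ε / 2) (by positivity)
    refine ⟨φ + ψ, N.add_mem hφ hψ, fun u => ?_⟩
    have := abs_add_le (f u - φ u) (g u - ψ u)
    simp only [ContinuousMap.add_apply, Pi.add_apply]
    rw [add_sub_add_comm]
    linarith [h1 u, h2 u]
  smul_mem' a f hf ε hε := by
    obtain ⟨φ, hφ, h1⟩ := hf (ε / (|a| + 1)) (by positivity)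
    refine ⟨a • φ, N.smul_mem a hφ, fun u => ?_⟩
    simp only [ContinuousMap.smul_apply, Pi.smul_apply, smul_eq_mul]
    rw [← mul_sub, abs_mul]
    calc |a| * |f u - φ u| ≤ (|a| + 1) * (ε / (|a| + 1)) := by
          gcongr
          · linarith
          · exact h1 u
      _ = ε := by field_simp

theorem isClosed_uniformLimits {E : Type*} [TopologicalSpace E] {Q : Set E} (hQ : IsCompact Q)
    (N : Submodule ℝ (E → ℝ)) : IsClosed (uniformLimits Q N : Set C(Q, ℝ)) := by
  have := isCompact_iff_compactSpace.1 hQ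
  refine isClosed_of_closure_subset fun f hf ε hε => ?_
  obtain ⟨g, hg, hfg⟩ := Metric.mem_closure_iff.1 hf (ε / 2) (by positivity)
  obtain ⟨ψ, hψ, h⟩ := hg (ε / 2) (by positivity)
  refine ⟨ψ, hψ, fun u => ?_⟩
  have h1 := (ContinuousMap.dist_apply_le_dist (f := f) (g := g) u).trans hfg.le
  rw [Real.dist_eq] at h1
  linarith [abs_sub_le (f u) (g u) (ψ u), h u]

/-- The exponential ridge functions `u ↦ exp ⟪w, u⟫` on a subset of `ℝᵈ`. -/
noncomputable def expRidge {d : ℕ} (Q : Set (EuclideanSpace ℝ (Fin d))) :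
    Multiplicative (EuclideanSpace ℝ (Fin d)) →* C(Q, ℝ) where
  toFun w := ⟨fun u => Real.exp (inner ℝ w.toAdd (u : EuclideanSpace ℝ (Fin d))), by fun_prop⟩
  map_one' := by ext; simp
  map_mul' w w' := by ext; simp [inner_add_left, Real.exp_add]

/-- A ridge function depends on the single variable `⟪w, u⟫`, bounded on `Q`, so the one-dimensional
approximation of `exp` applies; a dilation by `p` there becomes a neuron of weight `p • w`. -/
theorem expRidge_mem_uniformLimits {d : ℕ} {σ : ℝ → ℝ} (hσ : IsSigmoidal σ)
    {Q : Set (EuclideanSpace ℝ (Fin d))} (hQ : IsCompact Q)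
    (w : Multiplicative (EuclideanSpace ℝ (Fin d))) :
    expRidge Q w ∈ uniformLimits Q (shallowNet d σ) := by
  intro ε hε
  obtain ⟨M, hM⟩ := hQ.exists_bound_of_continuousOn
    (f := fun u => inner ℝ w.toAdd u) (by fun_prop)
  obtain ⟨g, hg, h⟩ := hσ.exists_approx_Icc Real.continuous_exp (-M) M hε
  refine ⟨fun u => g (inner ℝ w.toAdd u), ?_, fun u => h _ (abs_le.1 (hM u u.2))⟩
  clear h
  induction hg using Submodule.span_induction with
  | mem x hx =>
    obtain ⟨p, rfl⟩ := hx
    simpa [real_inner_smul_left] using neuron_mem_shallowNet σ (p.1 • w.toAdd) p.2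
  | zero => exact Submodule.zero_mem _
  | add x y _ _ hx hy => exact Submodule.add_mem _ hx hy
  | smul a x _ hx => exact Submodule.smul_mem _ a hx

/-- Universal approximation: shallow networks are uniformly dense in `C(Q)`, `Q` compact. -/
theorem uniformLimits_shallowNet {d : ℕ} {σ : ℝ → ℝ} (hσ : IsSigmoidal σ)
    {Q : Set (EuclideanSpace ℝ (Fin d))} (hQ : IsCompact Q) :
    uniformLimits Q (shallowNet d σ) = ⊤ := by
  have := isCompact_iff_compactSpace.1 hQ
  set S : Subalgebra ℝ C(Q, ℝ) := Algebra.adjoin ℝ (MonoidHom.mrange (expRidge Q))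
  have hS : S.toSubmodule ≤ uniformLimits Q (shallowNet d σ) := by
    -- Products of exponential ridge functions are again such functions, so the algebra they
    -- generate is just their linear span.
    rw [Algebra.adjoin_eq_span, Submonoid.closure_eq, Submodule.span_le]
    rintro _ ⟨w, rfl⟩
    exact expRidge_mem_uniformLimits hσ hQ w
  have hsep : S.SeparatesPoints := by
    intro x y hxy
    refine ⟨_, ⟨expRidge Q (.ofAdd (x - y : EuclideanSpace ℝ (Fin d))),
      Algebra.subset_adjoin ⟨_, rfl⟩, rfl⟩, fun h => hxy ?_⟩
    have h1 := Real.exp_injective h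
    simp only [toAdd_ofAdd] at h1
    rw [← sub_eq_zero, ← inner_sub_right, inner_self_eq_zero, sub_eq_zero] at h1
    exact Subtype.ext h1
  have htop := ContinuousMap.subalgebra_topologicalClosure_eq_top_of_separatesPoints S hsep
  refine eq_top_iff.2 fun f _ => ?_
  have hf : f ∈ closure (S : Set C(Q, ℝ)) := by
    rw [← Subalgebra.topologicalClosure_coe, htop]; trivial
  exact closure_minimal hS (isClosed_uniformLimits hQ _) hf

/-! ### Uniform approximation of continuous kernels -/

/-- A uniformly fine partition of unity on a compact set, indexed by points of the set. -/
theorem IsCompact.exists_fine_partition {E : Type*} [MetricSpace E] {Q : Set E}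
    (hQ : IsCompact Q) {δ : ℝ} (hδ : 0 < δ) :
    ∃ (n : ℕ) (x : Fin n → E) (φ : Fin n → C(Q, ℝ)), (∀ i, x i ∈ Q) ∧ (∀ i u, 0 ≤ φ i u) ∧
      (∀ u, ∑ i, φ i u = 1) ∧ ∀ i u, φ i u ≠ 0 → dist (u : E) (x i) < δ := by
  obtain ⟨t, htQ, htf, hcov⟩ := hQ.finite_cover_balls hδ
  have := htf.fintype
  let e := (Fintype.equivFin t).symm
  let β : Fin (Fintype.card t) → Q → ℝ := fun i u => max 0 (δ - dist (u : E) (e i))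
  have hβ : ∀ i u, 0 ≤ β i u := fun i u => le_max_left _ _
  have hβc : ∀ i, Continuous (β i) := fun i => by fun_prop
  have hpos : ∀ u, 0 < ∑ i, β i u := by
    intro u
    obtain ⟨y, hy, huy⟩ := Set.mem_iUnion₂.1 (hcov u.2)
    refine Finset.sum_pos' (fun i _ => hβ i u) ⟨e.symm ⟨y, hy⟩, Finset.mem_univ _, ?_⟩
    simp only [β, Equiv.apply_symm_apply]
    exact lt_max_of_lt_right (sub_pos.2 huy)
  refine ⟨Fintype.card t, fun i => e i, fun i => ⟨fun u => β i u / ∑ j, β j u,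
    (hβc i).div (continuous_finsetSum _ fun j _ => hβc j) fun u => (hpos u).ne'⟩,
    fun i => htQ (e i).2, fun i u => div_nonneg (hβ i u) (hpos u).le, fun u => ?_,
    fun i u h => ?_⟩
  · simp only [ContinuousMap.coe_mk]
    rw [← Finset.sum_div, div_self (hpos u).ne']
  · by_contra! hd
    exact h (by simp [β, hd])

/-- A continuous kernel on a compact set is uniformly approximated by combinations of products of
elements of a dense space of functions, with a matrix of values of the kernel as coefficients. -/
theorem exists_tensor_approx {E : Type*} [MetricSpace E] {Q : Set E} (hQ : IsCompact Q)
    {N : Submodule ℝ (E → ℝ)} (hN : uniformLimits Q N = ⊤) {c : E → E → ℝ}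
    (hc : ContinuousOn (Function.uncurry c) (Q ×ˢ Q)) {ε : ℝ} (hε : 0 < ε) :
    ∃ (n : ℕ) (x : Fin n → E) (ψ : Fin n → E → ℝ), (∀ i, x i ∈ Q) ∧ (∀ i, ψ i ∈ N) ∧
      ∀ u ∈ Q, ∀ v ∈ Q, |c u v - ∑ i, ∑ j, c (x i) (x j) * ψ i u * ψ j v| ≤ ε := by
  obtain ⟨δ, hδ, hcδ⟩ := Metric.uniformContinuousOn_iff.1
    ((hQ.prod hQ).uniformContinuousOn_of_continuous hc) (ε / 2) (by positivity)
  obtain ⟨B, hB⟩ := (hQ.prod hQ).exists_bound_of_continuousOn hc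
  obtain ⟨n, x, φ, hx, hφ0, hφ1, hφx⟩ := hQ.exists_fine_partition hδ
  -- Each of the `n * n` terms changes by at most `(|B| + 1) * 3 * η`; the bound `η ≤ 1` gives `|ψ
  -- j| ≤ 2`, and the final `+ 1` covers `n = 0`.
  set η : ℝ := min 1 (ε / 2 / ((n * n) * ((|B| + 1) * 3) + 1)) with hη
  have hη0 : 0 < η := by positivity
  have h := fun i => (hN ▸ Submodule.mem_top : φ i ∈ uniformLimits Q N) η hη0
  choose ψ hψN hψ using h
  refine ⟨n, x, ψ, hx, hψN, fun u hu v hv => ?_⟩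
  -- Both `c u v` and `ε / 2` are averages of themselves against the partition of unity; only the
  -- terms with `(u, v)` within `δ` of `(x i, x j)` survive.
  have h1 : |c u v - ∑ i, ∑ j, c (x i) (x j) * φ i ⟨u, hu⟩ * φ j ⟨v, hv⟩| ≤ ε / 2 := by
    have e1 : c u v = ∑ i, ∑ j, c u v * φ i ⟨u, hu⟩ * φ j ⟨v, hv⟩ := by
      simp_rw [← Finset.mul_sum, hφ1, mul_one]
      rw [← Finset.mul_sum, hφ1, mul_one]
    have e2 : ε / 2 = ∑ i, ∑ j, (ε / 2) * φ i ⟨u, hu⟩ * φ j ⟨v, hv⟩ := by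
      simp_rw [← Finset.mul_sum, hφ1, mul_one]
      rw [← Finset.mul_sum, hφ1, mul_one]
    rw [e2]
    nth_rw 1 [e1]
    simp_rw [← Finset.sum_sub_distrib, ← sub_mul]
    refine (Finset.abs_sum_le_sum_abs _ _).trans (Finset.sum_le_sum fun i _ =>
      (Finset.abs_sum_le_sum_abs _ _).trans (Finset.sum_le_sum fun j _ => ?_))
    rw [abs_mul, abs_mul, abs_of_nonneg (hφ0 _ _), abs_of_nonneg (hφ0 _ _)]
    rcases eq_or_ne (φ i ⟨u, hu⟩) 0 with h0 | h0
    · simp [h0]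
    rcases eq_or_ne (φ j ⟨v, hv⟩) 0 with h0' | h0'
    · simp [h0']
    have := hcδ (u, v) ⟨hu, hv⟩ (x i, x j) ⟨hx i, hx j⟩
      (by rw [Prod.dist_eq]; exact max_lt (hφx i _ h0) (hφx j _ h0'))
    gcongr
    · exact hφ0 _ _
    · exact hφ0 _ _
    · exact this.le
  have hφle : ∀ i w, φ i w ≤ 1 := fun i w => by
    rw [← hφ1 w]; exact Finset.single_le_sum (fun j _ => hφ0 j w) (Finset.mem_univ i)
  have h2 : |∑ i, ∑ j, c (x i) (x j) * φ i ⟨u, hu⟩ * φ j ⟨v, hv⟩ -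
      ∑ i, ∑ j, c (x i) (x j) * ψ i u * ψ j v| ≤ ε / 2 := by
    simp_rw [← Finset.sum_sub_distrib]
    calc _ ≤ ∑ _i : Fin n, ∑ _j : Fin n, (|B| + 1) * 3 * η := by
          refine (Finset.abs_sum_le_sum_abs _ _).trans (Finset.sum_le_sum fun i _ =>
            (Finset.abs_sum_le_sum_abs _ _).trans (Finset.sum_le_sum fun j _ => ?_))
          have a1 := hψ i ⟨u, hu⟩
          have a2 := hψ j ⟨v, hv⟩
          have a3 : |c (x i) (x j)| ≤ |B| + 1 :=
            (hB (x i, x j) ⟨hx i, hx j⟩).trans ((le_abs_self B).trans (by linarith))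
          have a4 : |φ i ⟨u, hu⟩| ≤ 1 := by
            rw [abs_of_nonneg (hφ0 _ _)]; exact hφle _ _
          have a5 : |ψ j v| ≤ 2 := by
            have b1 := abs_sub_abs_le_abs_sub (ψ j v) (φ j ⟨v, hv⟩)
            rw [abs_sub_comm, abs_of_nonneg (hφ0 j _)] at b1
            linarith [hφle j ⟨v, hv⟩, min_le_left 1 (ε / 2 / ((n * n) * ((|B| + 1) * 3) + 1))]
          rw [show c (x i) (x j) * φ i ⟨u, hu⟩ * φ j ⟨v, hv⟩ - c (x i) (x j) * ψ i u * ψ j v =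
            c (x i) (x j) * (φ i ⟨u, hu⟩ * (φ j ⟨v, hv⟩ - ψ j v) +
              (φ i ⟨u, hu⟩ - ψ i u) * ψ j v) by ring, abs_mul, mul_assoc]
          refine mul_le_mul a3 ((abs_add_le _ _).trans ?_) (abs_nonneg _) (by positivity)
          rw [abs_mul, abs_mul]
          calc _ ≤ 1 * η + η * 2 := by gcongr
            _ = 3 * η := by ring
      _ = ((n * n) * ((|B| + 1) * 3)) * η := by simp; ring
      _ ≤ ((n * n) * ((|B| + 1) * 3) + 1) * (ε / 2 / ((n * n) * ((|B| + 1) * 3) + 1)) := by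
          gcongr
          · linarith
          · exact min_le_right _ _
      _ = ε / 2 := by field_simp
  linarith [abs_sub_le (c u v) (∑ i, ∑ j, c (x i) (x j) * φ i ⟨u, hu⟩ * φ j ⟨v, hv⟩)
    (∑ i, ∑ j, c (x i) (x j) * ψ i u * ψ j v)]

/-- A continuous non-negative definite kernel is a uniform limit of shallow CovNet kernels. -/
theorem IsNonnegDefiniteOn.exists_shallowCovNet {d : ℕ} {σ : ℝ → ℝ} (hσ : IsSigmoidal σ)
    {Q : Set (EuclideanSpace ℝ (Fin d))} (hQ : IsCompact Q)
    {c : EuclideanSpace ℝ (Fin d) → EuclideanSpace ℝ (Fin d) → ℝ}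
    (hc : ContinuousOn (Function.uncurry c) (Q ×ˢ Q)) (hpos : IsNonnegDefiniteOn Q c)
    {ε : ℝ} (hε : 0 < ε) :
    ∃ R : ℕ, 1 ≤ R ∧ ∃ g ∈ shallowCovNet d σ R, ∀ u ∈ Q, ∀ v ∈ Q, |c u v - g u v| ≤ ε := by
  obtain ⟨n, x, ψ, hx, hψ, h⟩ := exists_tensor_approx hQ (uniformLimits_shallowNet hσ hQ) hc hε
  obtain ⟨R, hR, hg⟩ := exists_mem_shallowCovNet (hpos n x hx) ψ hψ
  exact ⟨R, hR, _, hg, h⟩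

/-! ### Positivity of the covariance operator and of its kernel -/

/-- The norm of `Y ⊗ Y` is `‖Y‖ ^ 2`, so the operator-valued integrand is Bochner integrable and the
expectation commutes with evaluation at `g` and pairing with `f`. -/
theorem inner_covOperator {H : Type*} [NormedAddCommGroup H] [InnerProductSpace ℝ H]
    [CompleteSpace H] {Ω : Type*} [MeasurableSpace Ω] {P : Measure Ω} [IsProbabilityMeasure P]
    {X : Ω → H} (hX : MemLp X 2 P) (f g : H) :
    inner ℝ f (covOperator P X g) =
      ∫ ω, inner ℝ (X ω - ∫ ω', X ω' ∂P) f * inner ℝ (X ω - ∫ ω', X ω' ∂P) g ∂P := by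
  set Y : Ω → H := fun ω => X ω - ∫ ω', X ω' ∂P with hY
  have hY2 : MemLp Y 2 P := hX.sub (memLp_const _)
  have hint : Integrable (fun ω => InnerProductSpace.rankOne ℝ (Y ω) (Y ω)) P := by
    refine (hY2.integrable_norm_pow two_ne_zero).mono' ?_ (ae_of_all _ fun ω => ?_)
    · exact ((InnerProductSpace.rankOne ℝ).continuous.clm_apply continuous_id :
        Continuous fun y : H => InnerProductSpace.rankOne ℝ y y).comp_aestronglyMeasurable hY2.aestronglyMeasurable
    · rw [InnerProductSpace.norm_rankOne, sq]
  have hap : covOperator P X g = ∫ ω, InnerProductSpace.rankOne ℝ (Y ω) (Y ω) g ∂P :=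
    ContinuousLinearMap.integral_apply hint g
  rw [hap, ← integral_inner (hint.apply_continuousLinearMap g) f]
  refine integral_congr_ae (ae_of_all _ fun ω => ?_)
  change inner ℝ f (InnerProductSpace.rankOne ℝ (Y ω) (Y ω) g) = inner ℝ (Y ω) f * inner ℝ (Y ω) g
  rw [InnerProductSpace.rankOne_apply, inner_smul_right, real_inner_comm f, mul_comm]

theorem isPositive_covOperator {H : Type*} [NormedAddCommGroup H] [InnerProductSpace ℝ H]
    [CompleteSpace H] {Ω : Type*} [MeasurableSpace Ω] {P : Measure Ω} [IsProbabilityMeasure P]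
    {X : Ω → H} (hX : MemLp X 2 P) : (covOperator P X).IsPositive := by
  refine ⟨fun f g => ?_, fun f => ?_⟩
  · rw [ContinuousLinearMap.coe_coe, real_inner_comm, inner_covOperator hX, inner_covOperator hX]
    simp_rw [mul_comm]
  · rw [ContinuousLinearMap.reApplyInnerSelf_apply, real_inner_comm, inner_covOperator hX]
    exact integral_nonneg fun ω => mul_self_nonneg _

/-- The quadratic form of this matrix at `x` is that of `T` at `∑ x i • f i`. -/
theorem ContinuousLinearMap.IsPositive.posSemidef_inner {H : Type*} [NormedAddCommGroup H]
    [InnerProductSpace ℝ H] {T : H →L[ℝ] H} (hT : T.IsPositive) {n : ℕ} (f : Fin n → H) :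
    (Matrix.of fun i j => inner ℝ (f i) (T (f j))).PosSemidef := by
  refine .of_dotProduct_mulVec_nonneg (Matrix.IsHermitian.ext fun i j => ?_) fun x => ?_
  · change inner ℝ (f j) (T (f i)) = inner ℝ (f i) (T (f j))
    rw [real_inner_comm]
    exact hT.1 _ _
  · have h := hT.2 (∑ i, x i • f i)
    rw [ContinuousLinearMap.reApplyInnerSelf_apply, real_inner_comm] at h
    refine h.trans_eq (Eq.symm ?_)
    simp [dotProduct, Matrix.mulVec, sum_inner, inner_sum, inner_smul_left, inner_smul_right,
      Finset.mul_sum, mul_comm]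
    rw [Finset.sum_comm]
    exact Finset.sum_congr rfl fun i _ => Finset.sum_congr rfl fun j _ => mul_left_comm _ _ _

theorem Matrix.posSemidef_of_tendsto {n : ℕ} {A : ℕ → Matrix (Fin n) (Fin n) ℝ}
    {B : Matrix (Fin n) (Fin n) ℝ} (hA : ∀ k, (A k).PosSemidef)
    (h : ∀ i j, Tendsto (fun k => A k i j) atTop (𝓝 (B i j))) : B.PosSemidef := by
  refine .of_dotProduct_mulVec_nonneg (Matrix.IsHermitian.ext fun i j => ?_) fun x => ?_
  · refine tendsto_nhds_unique (h j i) ((h i j).congr fun k => ?_)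
    simpa using (hA k).1.apply j i
  · refine ge_of_tendsto' (f := fun k => star x ⬝ᵥ (A k).mulVec x) (x := atTop) ?_
      fun k => (hA k).dotProduct_mulVec_nonneg x
    simp only [dotProduct, Matrix.mulVec]
    exact tendsto_finsetSum _ fun i _ => tendsto_const_nhds.mul
      (tendsto_finsetSum _ fun j _ => (h i j).mul tendsto_const_nhds)

/-- The kernel of an operator, continuous on a set charged everywhere by Lebesgue
measure, is recovered from matrix elements of the operator. -/
theorem IsKernelOf.exists_inner_approx {d : ℕ} {Q : Set (EuclideanSpace ℝ (Fin d))}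
    (hQ : IsCompact Q) {c : EuclideanSpace ℝ (Fin d) → EuclideanSpace ℝ (Fin d) → ℝ}
    {A : L2On Q →L[ℝ] L2On Q} (hc : IsKernelOf Q c A)
    (hcont : ContinuousOn (Function.uncurry c) (Q ×ˢ Q)) (hsupp : HasFullLebesgueSupport Q)
    {n : ℕ} {x : Fin n → EuclideanSpace ℝ (Fin d)} (hx : ∀ i, x i ∈ Q) {ε : ℝ} (hε : 0 < ε) :
    ∃ f : Fin n → L2On Q, ∀ i j, |inner ℝ (f i) (A (f j)) - c (x i) (x j)| ≤ ε := by
  set μ : Measure (EuclideanSpace ℝ (Fin d)) := volume.restrict Q with hμ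
  have : IsFiniteMeasure μ := ⟨by simpa [hμ] using hQ.measure_lt_top⟩
  obtain ⟨δ, hδ, hcδ⟩ := Metric.uniformContinuousOn_iff.1
    ((hQ.prod hQ).uniformContinuousOn_of_continuous hcont) ε hε
  have hB : ∀ i, MeasurableSet (Metric.ball (x i) δ) := fun i => measurableSet_ball
  -- Full support enters here: the averages below are over sets of positive measure.
  have hpos : ∀ i, μ (Metric.ball (x i) δ) ≠ 0 := fun i => by
    rw [hμ, Measure.restrict_apply (hB i), Set.inter_comm]
    exact (hsupp _ Metric.isOpen_ball ⟨x i, hx i, Metric.mem_ball_self hδ⟩).ne'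
  have hmemQ : ∀ᵐ u ∂μ, u ∈ Q := ae_restrict_mem hQ.measurableSet
  -- With normalized indicators of small balls, the matrix element is a double average of `c` near
  -- `(x i, x j)`. Averages stay in the closed convex ball of radius `ε` about `c (x i) (x j)`.
  refine ⟨fun i => (μ.real (Metric.ball (x i) δ))⁻¹ •
    indicatorConstLp 2 (hB i) (measure_ne_top μ _) (1 : ℝ), fun i j => ?_⟩
  set fj : L2On Q := (μ.real (Metric.ball (x j) δ))⁻¹ •
    indicatorConstLp 2 (hB j) (measure_ne_top μ _) (1 : ℝ) with hfj
  have hfj_ae : ∀ᵐ v ∂μ, fj v = (Metric.ball (x j) δ).indicator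
      (fun _ => (μ.real (Metric.ball (x j) δ))⁻¹) v := by
    filter_upwards [Lp.coeFn_smul (μ.real (Metric.ball (x j) δ))⁻¹
      (indicatorConstLp 2 (hB j) (measure_ne_top μ _) (1 : ℝ)),
      indicatorConstLp_coeFn (p := 2) (hs := hB j) (hμs := measure_ne_top μ _) (c := (1 : ℝ))]
      with v h1 h2
    rw [hfj, h1, Pi.smul_apply, h2]
    by_cases hv : v ∈ Metric.ball (x j) δ <;> simp [hv]
  have hAf : ∀ᵐ u ∂μ, A fj u = ⨍ v in Metric.ball (x j) δ, c u v ∂μ := by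
    filter_upwards [hc.2 fj] with u hu
    rw [hu, setAverage_eq, ← integral_smul, ← integral_indicator (hB j)]
    refine integral_congr_ae (hfj_ae.mono fun v hv => ?_)
    simp only [hv]
    by_cases hv' : v ∈ Metric.ball (x j) δ <;> simp [hv', mul_comm]
  have hclose : ∀ᵐ u ∂μ.restrict (Metric.ball (x i) δ),
      A fj u ∈ Metric.closedBall (c (x i) (x j)) ε := by
    filter_upwards [ae_restrict_of_ae hAf, ae_restrict_of_ae hmemQ, ae_restrict_mem (hB i)]
      with u h1 huQ huB
    rw [h1]
    refine (convex_closedBall _ _).set_average_mem Metric.isClosed_closedBall (hpos j)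
      (measure_ne_top μ _) ?_ ?_
    · filter_upwards [ae_restrict_of_ae hmemQ, ae_restrict_mem (hB j)] with v hvQ hvB
      refine (hcδ (u, v) ⟨huQ, hvQ⟩ (x i, x j) ⟨hx i, hx j⟩ ?_).le
      rw [Prod.dist_eq]
      exact max_lt huB hvB
    · refine Integrable.integrableOn (ContinuousOn.integrableOn_compact hQ ?_)
      exact hcont.comp (by fun_prop : Continuous fun v => (u, v)).continuousOn
        fun v hv => ⟨huQ, hv⟩
  rw [real_inner_smul_left, L2.inner_indicatorConstLp_one, ← smul_eq_mul, ← setAverage_eq,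
    ← Real.dist_eq]
  exact (convex_closedBall _ _).set_average_mem Metric.isClosed_closedBall (hpos i)
    (measure_ne_top μ _) hclose ((Lp.memLp (A fj)).integrable (by norm_num)).integrableOn

theorem IsKernelOf.isNonnegDefiniteOn {d : ℕ} {Q : Set (EuclideanSpace ℝ (Fin d))}
    (hQ : IsCompact Q) {c : EuclideanSpace ℝ (Fin d) → EuclideanSpace ℝ (Fin d) → ℝ}
    {A : L2On Q →L[ℝ] L2On Q} (hc : IsKernelOf Q c A) (hA : A.IsPositive)
    (hcont : ContinuousOn (Function.uncurry c) (Q ×ˢ Q)) (hsupp : HasFullLebesgueSupport Q) :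
    IsNonnegDefiniteOn Q c := by
  intro n x hx
  have h := fun k : ℕ => hc.exists_inner_approx hQ hcont hsupp hx
    (ε := 1 / ((k : ℝ) + 1)) Nat.one_div_pos_of_nat
  choose f hf using h
  refine Matrix.posSemidef_of_tendsto (fun k => hA.posSemidef_inner (f k)) fun i j => ?_
  rw [tendsto_iff_dist_tendsto_zero]
  exact squeeze_zero (fun _ => dist_nonneg) (fun k => hf k i j)
    tendsto_one_div_add_atTop_nhds_zero_nat

/-! ### Mean-square approximation by projection -/

/-- Fourier coefficients with respect to a finite orthonormal family give the best approximation in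
mean square. -/
theorem integral_sq_sub_orthonormal_le {α ι : Type*} [Fintype ι] [DecidableEq ι]
    [MeasurableSpace α] {ν : Measure α} {c : α → ℝ} (hc : MemLp c 2 ν) {G : ι → α → ℝ}
    (hG : ∀ i, MemLp (G i) 2 ν) (hon : ∀ i j, ∫ p, G i p * G j p ∂ν = if i = j then 1 else 0)
    (b : ι → ℝ) :
    ∫ p, (c p - ∑ i, (∫ q, c q * G i q ∂ν) * G i p) ^ 2 ∂ν ≤
      ∫ p, (c p - ∑ i, b i * G i p) ^ 2 ∂ν := by
  have hcG : ∀ i, Integrable (fun p => c p * G i p) ν := fun i => hc.integrable_mul (hG i)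
  have hGG : ∀ i j, Integrable (fun p => G i p * G j p) ν := fun i j =>
    (hG i).integrable_mul (hG j)
  -- Expanding the square makes the error explicit in `b`; completing the square, the excess over
  -- the Fourier choice is `∑ (b i - ∫ c G i) ^ 2`.
  have key : ∀ b : ι → ℝ, ∫ p, (c p - ∑ i, b i * G i p) ^ 2 ∂ν =
      ∫ p, c p ^ 2 ∂ν - 2 * ∑ i, b i * (∫ q, c q * G i q ∂ν) + ∑ i, b i ^ 2 := by
    intro b
    have hs : MemLp (fun p => ∑ i, b i * G i p) 2 ν :=
      memLp_finsetSum _ fun i _ => (hG i).const_mul (b i)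
    have h1 : ∫ p, c p * ∑ i, b i * G i p ∂ν = ∑ i, b i * (∫ q, c q * G i q ∂ν) := by
      simp_rw [Finset.mul_sum, mul_left_comm (c _)]
      rw [integral_finsetSum _ fun i _ => (hcG i).const_mul (b i)]
      simp_rw [integral_const_mul]
    have h2 : ∫ p, (∑ i, b i * G i p) ^ 2 ∂ν = ∑ i, b i ^ 2 := by
      have h3 : ∀ p, (∑ i, b i * G i p) ^ 2 = ∑ i, ∑ j, b i * b j * (G i p * G j p) := by
        intro p
        rw [sq, Finset.sum_mul_sum]
        exact Finset.sum_congr rfl fun i _ => Finset.sum_congr rfl fun j _ => by ring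
      simp_rw [h3]
      rw [integral_finsetSum _ fun i _ => integrable_finsetSum _ fun j _ =>
        (hGG i j).const_mul _]
      refine Finset.sum_congr rfl fun i _ => ?_
      rw [integral_finsetSum _ fun j _ => (hGG i j).const_mul _]
      simp_rw [integral_const_mul, hon]
      simp [sq]
    have hcs : Integrable (fun p => c p * ∑ i, b i * G i p) ν := hc.integrable_mul hs
    have hdiff : Integrable (fun p => c p ^ 2 - 2 * (c p * ∑ i, b i * G i p)) ν :=
      hc.integrable_sq.sub (hcs.const_mul 2)
    simp_rw [sub_sq, mul_assoc (2 : ℝ)]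
    rw [integral_add hdiff hs.integrable_sq,
      integral_sub hc.integrable_sq (hcs.const_mul 2), integral_const_mul, h1, h2]
  rw [key, key, ← sub_nonneg]
  refine (Finset.sum_nonneg fun i _ => sq_nonneg (b i - ∫ q, c q * G i q ∂ν)).trans_eq
    (?_ : ∑ i, (b i - ∫ q, c q * G i q ∂ν) ^ 2 = _)
  have : ∀ i, (b i - ∫ q, c q * G i q ∂ν) ^ 2 = b i ^ 2 - 2 * (b i * ∫ q, c q * G i q ∂ν) +
    (∫ q, c q * G i q ∂ν) * ∫ q, c q * G i q ∂ν := fun i => by ring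
  simp_rw [this, Finset.sum_add_distrib, Finset.sum_sub_distrib, ← Finset.mul_sum]
  simp_rw [sq]
  ring

theorem MemLp.mul_prod_two {α β : Type*} [MeasurableSpace α] [MeasurableSpace β] {μ : Measure α}
    {ν : Measure β} [IsFiniteMeasure μ] [IsFiniteMeasure ν] {f : α → ℝ} {g : β → ℝ}
    (hf : MemLp f 2 μ) (hg : MemLp g 2 ν) : MemLp (fun p : α × β => f p.1 * g p.2) 2 (μ.prod ν) := by
  refine (memLp_two_iff_integrable_sq
    (hf.aestronglyMeasurable.comp_fst.mul hg.aestronglyMeasurable.comp_snd)).2 ?_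
  simpa only [Pi.mul_apply, mul_pow] using hf.integrable_sq.mul_prod hg.integrable_sq

/-- Gram–Schmidt in `L²`, with representatives of the orthonormal family in a given space of
functions. -/
theorem exists_orthonormal_representatives {α : Type*} [MeasurableSpace α] {μ : Measure α}
    {N : Submodule ℝ (α → ℝ)} (hN : ∀ ψ ∈ N, MemLp ψ 2 μ) {n : ℕ} (ψ : Fin n → α → ℝ)
    (hψ : ∀ i, ψ i ∈ N) :
    ∃ (m : ℕ) (e : Fin m → Lp ℝ 2 μ) (e' : Fin m → α → ℝ) (p : Fin n → Fin m → ℝ),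
      Orthonormal ℝ e ∧ (∀ k, e' k ∈ N) ∧ (∀ k, e k =ᵐ[μ] e' k) ∧
      ∀ i, ψ i =ᵐ[μ] fun u => ∑ k, p i k * e' k u := by
  let V : Submodule ℝ (Lp ℝ 2 μ) :=
    Submodule.span ℝ (Set.range fun i => (hN _ (hψ i)).toLp (ψ i))
  have : FiniteDimensional ℝ V := FiniteDimensional.span_of_finite ℝ (Set.finite_range _)
  let b := stdOrthonormalBasis ℝ V
  -- CovNet kernels are evaluated pointwise, so each basis class needs a representative that is a
  -- genuine element of `N`.
  have hrep : ∀ f ∈ V, ∃ φ ∈ N, f =ᵐ[μ] φ := by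
    intro f hf
    induction hf using Submodule.span_induction with
    | mem f hf =>
      obtain ⟨i, rfl⟩ := hf
      exact ⟨ψ i, hψ i, MemLp.coeFn_toLp _⟩
    | zero => exact ⟨0, N.zero_mem, Lp.coeFn_zero _ _ _⟩
    | add f g _ _ hf hg =>
      obtain ⟨φ, hφ, h1⟩ := hf
      obtain ⟨χ, hχ, h2⟩ := hg
      exact ⟨φ + χ, N.add_mem hφ hχ, (Lp.coeFn_add f g).trans (h1.add h2)⟩
    | smul a f _ hf =>
      obtain ⟨φ, hφ, h1⟩ := hf
      exact ⟨a • φ, N.smul_mem a hφ, (Lp.coeFn_smul a f).trans (h1.const_smul a)⟩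
  choose e' he'N he' using fun k => hrep (b k) (b k).2
  let y : Fin n → V := fun i => ⟨(hN _ (hψ i)).toLp (ψ i), Submodule.subset_span ⟨i, rfl⟩⟩
  refine ⟨_, fun k => (b k : Lp ℝ 2 μ), e', fun i k => inner ℝ (b k) (y i),
    b.orthonormal.comp_linearIsometry V.subtypeₗᵢ, he'N, he', fun i => ?_⟩
  have hy : (hN _ (hψ i)).toLp (ψ i) = ∑ k, inner ℝ (b k) (y i) • (b k : Lp ℝ 2 μ) := by
    have := congrArg (Subtype.val : V → Lp ℝ 2 μ) (b.sum_repr' (y i))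
    simpa [y] using this.symm
  have h1 : ∀ᵐ u ∂μ, ∀ k, (inner ℝ (b k) (y i) • (b k : Lp ℝ 2 μ)) u =
      inner ℝ (b k) (y i) * e' k u := by
    refine ae_all_iff.2 fun k => ?_
    filter_upwards [Lp.coeFn_smul (inner ℝ (b k) (y i)) (b k : Lp ℝ 2 μ), he' k] with u h2 h3
    rw [h2, Pi.smul_apply, h3, smul_eq_mul]
  filter_upwards [MemLp.coeFn_toLp (hN _ (hψ i)), h1,
    Lp.coeFn_finsetSum Finset.univ fun k => inner ℝ (b k) (y i) • (b k : Lp ℝ 2 μ)] with u h2 h3 h4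
  rw [← h2, hy, h4, Finset.sum_apply]
  exact Finset.sum_congr rfl fun k _ => h3 k

theorem memLp_of_mem_shallowNet {d : ℕ} {σ : ℝ → ℝ} (hσ : IsSigmoidal σ)
    {μ : Measure (EuclideanSpace ℝ (Fin d))} [IsFiniteMeasure μ]
    {ψ : EuclideanSpace ℝ (Fin d) → ℝ} (hψ : ψ ∈ shallowNet d σ) : MemLp ψ 2 μ := by
  induction hψ using Submodule.span_induction with
  | mem f hf =>
    obtain ⟨q, rfl⟩ := hf
    refine MemLp.of_bound (hσ.monotone.measurable.comp
      (by fun_prop : Measurable fun u => inner ℝ q.1 u + q.2)).aestronglyMeasurable 1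
      (ae_of_all _ fun u => ?_)
    have := hσ.mem_Icc (inner ℝ q.1 u + q.2)
    rw [Real.norm_eq_abs, abs_of_nonneg this.1]
    exact this.2
  | zero => exact MemLp.zero
  | add f g _ _ hf hg => exact hf.add hg
  | smul a f _ hf => exact hf.const_smul a

/-- The coefficients of the kernel of an operator in a product orthonormal system are matrix
elements of the operator. -/
theorem IsKernelOf.integral_mul {d : ℕ} {Q : Set (EuclideanSpace ℝ (Fin d))}
    (hQ : IsCompact Q) {c : EuclideanSpace ℝ (Fin d) → EuclideanSpace ℝ (Fin d) → ℝ}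
    {A : L2On Q →L[ℝ] L2On Q} (hc : IsKernelOf Q c A) (f g : L2On Q) {f' g' : _ → ℝ}
    (hf : f =ᵐ[volume.restrict Q] f') (hg : g =ᵐ[volume.restrict Q] g') :
    ∫ p, c p.1 p.2 * (f' p.1 * g' p.2) ∂((volume.restrict Q).prod (volume.restrict Q)) =
      inner ℝ f (A g) := by
  have : IsFiniteMeasure (volume.restrict Q) := ⟨by simpa using hQ.measure_lt_top⟩
  have hcp : MemLp (Function.uncurry c) 2 ((volume.restrict Q).prod (volume.restrict Q)) := by
    rw [Measure.prod_restrict]; exact hc.1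
  have hfg := MemLp.mul_prod_two ((memLp_congr_ae hf).1 (Lp.memLp f))
    ((memLp_congr_ae hg).1 (Lp.memLp g))
  have hint : Integrable (fun p : EuclideanSpace ℝ (Fin d) × EuclideanSpace ℝ (Fin d) =>
      c p.1 p.2 * (f' p.1 * g' p.2)) ((volume.restrict Q).prod (volume.restrict Q)) :=
    hcp.integrable_mul hfg
  rw [integral_prod _ hint, L2.inner_def]
  refine integral_congr_ae ?_
  filter_upwards [hc.2 g, hf] with u h1 h2
  rw [h1, h2]
  simp only [RCLike.inner_apply, conj_trivial]
  rw [← integral_mul_const]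
  refine integral_congr_ae (hg.mono fun v h3 => ?_)
  simp only [h3]
  ring

/-- In mean square, a kernel on a compact set is approximated by combinations of products of
elements of a uniformly dense space of functions. -/
theorem exists_tensor_approx_integral_sq {E : Type*} [MetricSpace E] [SecondCountableTopology E]
    [LocallyCompactSpace E] [MeasurableSpace E] [BorelSpace E] {Q : Set E} (hQ : IsCompact Q)
    {μ : Measure E} [IsFiniteMeasure μ] (hμQ : ∀ᵐ u ∂μ, u ∈ Q) [(μ.prod μ).Regular]
    {N : Submodule ℝ (E → ℝ)} (hN : uniformLimits Q N = ⊤) {c : E × E → ℝ} (hc : MemLp c 2 (μ.prod μ)) {ε : ℝ} (hε : 0 < ε) :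
    ∃ (n : ℕ) (a : Fin n → Fin n → ℝ) (ψ : Fin n → E → ℝ), (∀ i, ψ i ∈ N) ∧
      ∫ p, (c p - ∑ i, ∑ j, a i j * (ψ i p.1 * ψ j p.2)) ^ 2 ∂(μ.prod μ) ≤ ε := by
  -- Density of compactly supported continuous functions in `L²`. By `(x + y) ^ 2 ≤ 2 x ^ 2 + 2 y ^
  -- 2`, mean-square errors `ε / 4` for `c - c₀` and for the tensor approximation of `c₀` suffice;
  -- the latter explains the uniform tolerance `√(ε / 4 / (K + 1))`.
  obtain ⟨c₀, -, hcc, hc₀, hc₀2⟩ := MemLp.exists_hasCompactSupport_integral_rpow_sub_le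
    (p := 2) (by norm_num) (by simpa using hc) (ε := ε / 4) (by positivity)
  set K := (μ.prod μ).real Set.univ
  have hK : 0 ≤ K := measureReal_nonneg
  obtain ⟨n, x, ψ, -, hψN, h⟩ := exists_tensor_approx hQ hN (c := fun u v => c₀ (u, v))
    hc₀.continuousOn (ε := √(ε / 4 / (K + 1))) (by positivity)
  refine ⟨n, fun i j => c₀ (x i, x j), ψ, hψN, ?_⟩
  simp only [Real.rpow_two, Real.norm_eq_abs, sq_abs] at hcc
  have hc₀2' : MemLp c₀ 2 (μ.prod μ) := by simpa using hc₀2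
  have hint : Integrable (fun p => (c p - c₀ p) ^ 2) (μ.prod μ) := (hc.sub hc₀2').integrable_sq
  have hQ2 : ∀ᵐ p ∂(μ.prod μ), p.1 ∈ Q ∧ p.2 ∈ Q :=
    (Measure.quasiMeasurePreserving_fst.ae hμQ).and (Measure.quasiMeasurePreserving_snd.ae hμQ)
  calc _ ≤ ∫ p, (2 * (c p - c₀ p) ^ 2 + 2 * (ε / 4 / (K + 1))) ∂(μ.prod μ) := by
        refine integral_mono_of_nonneg (ae_of_all _ fun p => sq_nonneg _)
          ((hint.const_mul 2).add (integrable_const _)) (hQ2.mono fun p hp => ?_)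
        have h1 := h p.1 hp.1 p.2 hp.2
        simp only [mul_assoc] at h1
        have h2 := (sq_le_sq₀ (abs_nonneg _) (Real.sqrt_nonneg _)).2 h1
        rw [sq_abs, Real.sq_sqrt (by positivity)] at h2
        simp only [Prod.mk.eta] at h2 ⊢
        nlinarith [sq_nonneg ((c p - c₀ p) -
          (c₀ p - ∑ i, ∑ j, c₀ (x i, x j) * (ψ i p.1 * ψ j p.2)))]
    _ = 2 * ∫ p, (c p - c₀ p) ^ 2 ∂(μ.prod μ) + K * (2 * (ε / 4 / (K + 1))) := by
        rw [integral_add (hint.const_mul 2) (integrable_const _), integral_const_mul,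
          integral_const, smul_eq_mul]
    _ ≤ 2 * (ε / 4) + (K + 1) * (2 * (ε / 4 / (K + 1))) := by gcongr; linarith
    _ = ε := by field_simp; ring

/-- The kernel of a positive operator on `L²(Q)` is approximated in mean square by shallow CovNet
kernels. -/
theorem IsKernelOf.exists_shallowCovNet {d : ℕ} {σ : ℝ → ℝ} (hσ : IsSigmoidal σ)
    {Q : Set (EuclideanSpace ℝ (Fin d))} (hQ : IsCompact Q)
    {c : EuclideanSpace ℝ (Fin d) → EuclideanSpace ℝ (Fin d) → ℝ}
    {A : L2On Q →L[ℝ] L2On Q} (hc : IsKernelOf Q c A) (hA : A.IsPositive) {ε : ℝ} (hε : 0 < ε) :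
    ∃ R : ℕ, 1 ≤ R ∧ ∃ g ∈ shallowCovNet d σ R,
      IntegrableOn (fun p : EuclideanSpace ℝ (Fin d) × EuclideanSpace ℝ (Fin d) =>
          |c p.1 p.2 - g p.1 p.2| ^ 2) (Q ×ˢ Q) ∧
        ∫ p in Q ×ˢ Q, |c p.1 p.2 - g p.1 p.2| ^ 2 ≤ ε := by
  set μ : Measure (EuclideanSpace ℝ (Fin d)) := volume.restrict Q with hμ
  have hfin : IsFiniteMeasure μ := ⟨by simpa [hμ] using hQ.measure_lt_top⟩
  have hprod : (volume.restrict (Q ×ˢ Q) :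
      Measure (EuclideanSpace ℝ (Fin d) × EuclideanSpace ℝ (Fin d))) = μ.prod μ := by
    rw [hμ, Measure.prod_restrict]; rfl
  have hcp : MemLp (Function.uncurry c) 2 (μ.prod μ) := by rw [← hprod]; exact hc.1
  have hN2 : ∀ ψ ∈ shallowNet d σ, MemLp ψ 2 μ := fun ψ => memLp_of_mem_shallowNet hσ
  obtain ⟨n, a, ψ, hψ, happ⟩ := exists_tensor_approx_integral_sq hQ
    (ae_restrict_mem hQ.measurableSet : ∀ᵐ u ∂μ, u ∈ Q) (uniformLimits_shallowNet hσ hQ) hcp hε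
  obtain ⟨m, e, e', q, hon, he'N, hee', hψe⟩ := exists_orthonormal_representatives hN2 ψ hψ
  have hG : ∀ i : Fin m × Fin m, MemLp (fun p : EuclideanSpace ℝ (Fin d) × _ =>
      e' i.1 p.1 * e' i.2 p.2) 2 (μ.prod μ) :=
    fun i => MemLp.mul_prod_two (hN2 _ (he'N _)) (hN2 _ (he'N _))
  have he' : ∀ k l, ∫ u, e' k u * e' l u ∂μ = if k = l then 1 else 0 := by
    intro k l
    rw [← orthonormal_iff_ite.1 hon k l, L2.inner_def]
    refine integral_congr_ae ?_
    filter_upwards [hee' k, hee' l] with u h1 h2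
    simp [h1, h2, mul_comm]
  have honG : ∀ i j : Fin m × Fin m, ∫ p, (e' i.1 p.1 * e' i.2 p.2) * (e' j.1 p.1 * e' j.2 p.2)
      ∂(μ.prod μ) = if i = j then 1 else 0 := by
    intro i j
    simp_rw [mul_mul_mul_comm]
    rw [integral_prod_mul (fun u => e' i.1 u * e' j.1 u) (fun v => e' i.2 v * e' j.2 v), he', he']
    simp only [Prod.ext_iff, ite_and]
    split_ifs <;> simp
  have hmat : ∀ i : Fin m × Fin m, ∫ p, Function.uncurry c p * (e' i.1 p.1 * e' i.2 p.2)
      ∂(μ.prod μ) = inner ℝ (e i.1) (A (e i.2)) :=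
    fun i => hc.integral_mul hQ (e i.1) (e i.2) (hee' i.1) (hee' i.2)
  have hψe2 : ∀ᵐ p ∂(μ.prod μ), ∀ i, ψ i p.1 = ∑ k, q i k * e' k p.1 ∧
      ψ i p.2 = ∑ k, q i k * e' k p.2 :=
    ae_all_iff.2 fun i => (Measure.quasiMeasurePreserving_fst.ae (hψe i)).and
      (Measure.quasiMeasurePreserving_snd.ae (hψe i))
  -- The competitor `b` is the given approximant rewritten in the system `e' k ⊗ e' l`; by `hmat`
  -- the optimal coefficients are matrix elements of `A`, which form a positive semi-definite
  -- matrix.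
  have hbest := integral_sq_sub_orthonormal_le hcp hG honG
    (fun i => ∑ s, ∑ t, a s t * (q s i.1 * q t i.2))
  obtain ⟨R, hR, hg⟩ := exists_mem_shallowCovNet (hA.posSemidef_inner e) e' he'N
  have hgeq : ∀ p : EuclideanSpace ℝ (Fin d) × EuclideanSpace ℝ (Fin d),
      c p.1 p.2 - ∑ i, ∑ j, (Matrix.of fun i j => inner ℝ (e i) (A (e j))) i j * e' i p.1 * e' j p.2
      = Function.uncurry c p - ∑ i : Fin m × Fin m,
        (∫ q, Function.uncurry c q * (e' i.1 q.1 * e' i.2 q.2) ∂(μ.prod μ)) *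
          (e' i.1 p.1 * e' i.2 p.2) := by
    intro p
    simp_rw [hmat, Fintype.sum_prod_type, Matrix.of_apply, mul_assoc]
    rfl
  refine ⟨R, hR, _, hg, ?_, ?_⟩
  · rw [IntegrableOn, hprod]
    simp_rw [sq_abs, hgeq]
    exact (hcp.sub (memLp_finsetSum _ fun i _ => (hG i).const_mul _)).integrable_sq
  · rw [hprod]
    simp_rw [sq_abs, hgeq]
    refine hbest.trans (le_of_eq_of_le (integral_congr_ae (hψe2.mono fun p hp => ?_)) happ)
    simp only [hp]
    congr 2
    simp_rw [Fintype.sum_prod_type, Finset.sum_mul_sum, Finset.mul_sum, Finset.sum_mul]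
    simp_rw [Finset.sum_comm (s := (Finset.univ : Finset (Fin m))) (t := (Finset.univ : Finset (Fin n)))]
    refine Finset.sum_congr rfl fun s _ => Finset.sum_congr rfl fun t _ =>
      Finset.sum_congr rfl fun k _ => Finset.sum_congr rfl fun l _ => ?_
    ring

theorem theorem1 {d : ℕ} {Q : Set (EuclideanSpace ℝ (Fin d))} (hQ : IsCompact Q)
    {Ω : Type*} [MeasurableSpace Ω] (P : Measure Ω) [IsProbabilityMeasure P]
    (X : Ω → L2On Q) (hX : MemLp X 2 P)
    (c : EuclideanSpace ℝ (Fin d) → EuclideanSpace ℝ (Fin d) → ℝ)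
    (hc : IsKernelOf Q c (covOperator P X))
    (σ : ℝ → ℝ) (hσ : IsSigmoidal σ) :
    (∀ ε : ℝ, 0 < ε → ∃ R : ℕ, 1 ≤ R ∧ ∃ g ∈ shallowCovNet d σ R,
      IntegrableOn (fun p : EuclideanSpace ℝ (Fin d) × EuclideanSpace ℝ (Fin d) =>
          |c p.1 p.2 - g p.1 p.2| ^ 2) (Q ×ˢ Q) ∧
        ∫ p in Q ×ˢ Q, |c p.1 p.2 - g p.1 p.2| ^ 2 ≤ ε) ∧
    (ContinuousOn (Function.uncurry c) (Q ×ˢ Q) →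
      (HasFullLebesgueSupport Q ∨ IsNonnegDefiniteOn Q c) →
      ∀ ε : ℝ, 0 < ε → ∃ R : ℕ, 1 ≤ R ∧ ∃ g ∈ shallowCovNet d σ R,
        ∀ u ∈ Q, ∀ v ∈ Q, |c u v - g u v| ≤ ε) := by
  have hpos := isPositive_covOperator hX
  refine ⟨fun ε hε => hc.exists_shallowCovNet hσ hQ hpos hε, fun hcont h ε hε => ?_⟩
  exact (h.elim (hc.isNonnegDefiniteOn hQ hpos hcont) id).exists_shallowCovNet hσ hQ hcont hε
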